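/- The Avoider-Enforcer game on a finite graph $G=(V,E)$ is played by two players, Avoider and Enforcer, who alternately pick a not yet picked vertex of $G$ until all vertices have been picked; Enforcer wins if Avoider has picked both ends of some edge of $G$, otherwise Avoider wins. A player is the \emph{last} player if they move first and $|V|$ is odd or they move second and $|V|$ is even; the other player is the \emph{second-to-last} player. The outcome of $G$ is $o(G)=\mathcal{A}$ if Avoider has a winning strategy both as last and as second-to-last player, $o(G)=\mathcal{E}$ if Enforcer has a winning strategy both as last and as second-to-last player, and $o(G)=\mathcal{SL}$ if each of the two players has a winning strategy as second-to-last player. Let $P_3$ be the path on three vertices, $2P_3$ the disjoint union of two copies of $P_3$, $C_4$ the cycle on four vertices, and let the 3-sunlet be the graph obtained from a triangle by adding one pendent edge at each of its three vertices. Subgraphs need not be induced. \textbf{Theorem 3.} Let $G$ be a finite simple graph. \begin{itemize} \item $o(G)=\mathcal{A}$ if and only if $G$ does not contain $P_3$ as a subgraph; \item $o(G)=\mathcal{E}$ if and only if $G$ contains $2P_3$, $C_4$ or the 3-sunlet as a subgraph; \item $o(G)=\mathcal{SL}$ in all other cases, and only in those. \end{itemize} -/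

import Mathlib

namespace AvoiderEnforcer

/-- The two players of an Avoider-Enforcer game. -/
inductive Player
  | avoider
  | enforcer

/-- The opponent of a player. -/
def Player.other : Player → Player
  | .avoider => .enforcer
  | .enforcer => .avoider

/-- The set of vertices picked by Avoider after player `p` has picked `v`, if it was `A` before. -/
def pick {V : Type*} (p : Player) (v : V) (A : Set V) : Set V :=
  match p with
  | .avoider => insert v A
  | .enforcer => A

/-- The winner of a finished game in which Avoider's picks form the set `A`: Enforcer has won if
Avoider has filled some edge, otherwise Avoider has won. -/
def HasWon {V : Type*} (H : Hypergraph V) (A : Set V) : Player → Prop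
  | .avoider => ∀ e ∈ H.edgeSet, ¬ e ⊆ A
  | .enforcer => ∃ e ∈ H.edgeSet, e ⊆ A

/-- `WinsFrom H p q A F`: player `p` has a winning strategy in the Avoider-Enforcer game on `H` from
the position where it is `q`'s turn to move, Avoider has picked the vertices of `A` and the
vertices of `F` have not been picked yet. A derivation is a winning strategy tree for `p`. -/
inductive WinsFrom {V : Type*} (H : Hypergraph V) (p : Player) : Player → Set V → Set V → Prop
  /-- All vertices have been picked. -/
  | finished (q : Player) (A : Set V) (h : HasWon H A p) : WinsFrom H p q A ∅
  /-- It is `p`'s turn: some pick has to lead to a position won by `p`. -/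
  | ownMove (A F : Set V) (v : V) (hv : v ∈ F)
      (h : WinsFrom H p p.other (pick p v A) (F \ {v})) : WinsFrom H p p A F
  /-- It is the opponent's turn: every pick has to lead to a position won by `p`. -/
  | otherMove (A F : Set V) (hF : F.Nonempty)
      (h : ∀ v ∈ F, WinsFrom H p p (pick p.other v A) (F \ {v})) : WinsFrom H p p.other A F

/-- `p` has a winning strategy for the game on `H` in which `q` is the first player. -/
def WinsWithFirst {V : Type*} (H : Hypergraph V) (p q : Player) : Prop :=
  WinsFrom H p q ∅ H.vertexSet

open Classical in
/-- The first player of the game on `H` in which `l` is the last player: it is `l` if the number of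
vertices is odd, and the opponent of `l` if it is even. -/
noncomputable def firstPlayer {V : Type*} (H : Hypergraph V) (l : Player) : Player :=
  if Odd H.vertexSet.ncard then l else l.other

/-- `p` wins on `H` as last player. -/
def WinsAsLast {V : Type*} (H : Hypergraph V) (p : Player) : Prop :=
  WinsWithFirst H p (firstPlayer H p)

/-- `p` wins on `H` as second-to-last player, i.e. when the opponent of `p` is the last player. -/
def WinsAsSecondToLast {V : Type*} (H : Hypergraph V) (p : Player) : Prop :=
  WinsWithFirst H p (firstPlayer H p.other)

/-- The possible outcomes: Avoider wins, Enforcer wins, the second-to-last player wins. -/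
inductive Outcome
  | A
  | E
  | SL

/-- `HasOutcome H o` says that the Avoider-Enforcer game on `H` has outcome `o`. -/
def HasOutcome {V : Type*} (H : Hypergraph V) : Outcome → Prop
  | .A => WinsAsLast H .avoider ∧ WinsAsSecondToLast H .avoider
  | .E => WinsAsLast H .enforcer ∧ WinsAsSecondToLast H .enforcer
  | .SL => WinsAsSecondToLast H .avoider ∧ WinsAsSecondToLast H .enforcer

/-- A graph viewed as a 2-uniform hypergraph on all of its vertices. -/
def graphHypergraph {V : Type*} (G : SimpleGraph V) : Hypergraph V where
  vertexSet := Set.univ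
  edgeSet := {e | ∃ x y, G.Adj x y ∧ e = {x, y}}
  subset_vertexSet_of_mem_edgeSet' := fun _ _ => Set.subset_univ _

/-- The graph `2P₃`: two vertex-disjoint paths on three vertices. -/
def twoP3 : SimpleGraph (Fin 3 ⊕ Fin 3) :=
  SimpleGraph.sum (SimpleGraph.pathGraph 3) (SimpleGraph.pathGraph 3)

/-- The 3-sunlet: a triangle `inl 0, inl 1, inl 2` with a pendent edge `inl i – inr i` added at each
of its vertices. -/
def sunlet3 : SimpleGraph (Fin 3 ⊕ Fin 3) where
  Adj
    | .inl i, .inl j => i ≠ j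
    | .inl i, .inr j => i = j
    | .inr i, .inl j => i = j
    | .inr _, .inr _ => False
  symm := ⟨by rintro (i | i) (j | j) h <;> first | exact h.symm | exact h⟩
  loopless := ⟨by rintro (i | i) h <;> first | exact h rfl | exact h⟩

/-- `G` contains `2P₃`, `C₄` or the 3-sunlet as a (not necessarily induced) subgraph. -/
def ContainsForbidden {V : Type*} (G : SimpleGraph V) : Prop :=
  twoP3.IsContained G ∨ (SimpleGraph.cycleGraph 4).IsContained G ∨ sunlet3.IsContained G

end AvoiderEnforcer

namespace AvoiderEnforcer

open Player

/-! No position is won by both players, so it suffices to exhibit strategies.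

Enforcer: a spare free vertex, with the turn passed to the other player, never hurts Enforcer
(`WinsFrom.enforcer_insert`). Hence a win on a set of vertices extends to the whole board with the
same last player (`WinsFrom.enforcer_extend`), and only the small patterns have to be played,
Avoider moving first. `P₃` has odd order, which makes Avoider last; `2P₃`, `C₄` and the 3-sunlet
have even order, which makes Enforcer last. Enforcer's answers leave dead vertices, that is,
neighbours of Avoider's picks, until Avoider must take one.

Avoider: with Avoider to move and an even number of vertices left, Enforcer takes the last one, so
Avoider can afford one vertex that must never be picked, provided that the others span a matching
and are not dead (`winsFrom_avoider_of_matching`). As second-to-last player without forbidden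
subgraphs, Avoider takes isolated vertices of the remaining graph while there are any; afterwards
some vertex meets every `P₃` (`exists_meetsPaths`) and serves as the exception. Its existence rests
on parity: without `2P₃` and isolated vertices, everything outside a component containing a `P₃` is
perfectly matched, so in even order that component is not of order five. This excludes five-cycles
and bulls (triangles with pendent edges at two vertices); the required vertex is then found on a
triangle or on a path with five, four or three vertices. -/

/-! ### Exclusivity and monotonicity of wins -/

theorem WinsFrom.not_avoider_and_enforcer {V : Type*} {H : Hypergraph V} {q : Player}
    {A F : Set V} (h : WinsFrom H avoider q A F) : ¬ WinsFrom H enforcer q A F := by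
  induction h with
  | finished q A h =>
    intro h'
    cases h' with
    | finished _ _ h' =>
      obtain ⟨e, he, hs⟩ := h'
      exact h e he hs
    | ownMove _ _ v hv _ => exact hv
    | otherMove _ _ hF _ => exact Set.not_nonempty_empty hF
  | ownMove A F v hv _ ih =>
    intro h'
    cases h' with
    | finished => exact hv
    | otherMove _ _ _ h' => exact ih (h' v hv)
  | otherMove A F hF _ ih =>
    intro h'
    cases h' with
    | finished => exact Set.not_nonempty_empty hF
    | ownMove _ _ v hv h' => exact ih v hv h'

theorem WinsFrom.enforcer_mono {V : Type*} {H : Hypergraph V} {q : Player} {A F : Set V}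
    (h : WinsFrom H enforcer q A F) : ∀ {B : Set V}, A ⊆ B → WinsFrom H enforcer q B F := by
  induction h with
  | finished q A h =>
    intro B hB
    obtain ⟨e, he, hs⟩ := h
    exact .finished q B ⟨e, he, hs.trans hB⟩
  | ownMove A F v hv _ ih => exact fun hB => .ownMove _ F v hv (ih hB)
  | otherMove A F hF _ ih =>
    exact fun hB => .otherMove _ F hF fun v hv => ih v hv (Set.insert_subset_insert hB)

/-- Returning a vertex picked by Enforcer to the board, with the other player to move, preserves
a win of Enforcer. -/
theorem WinsFrom.enforcer_insert {V : Type*} {H : Hypergraph V} {q : Player} {A F : Set V}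
    (h : WinsFrom H enforcer q A F) {u : V} (hu : u ∉ F) :
    WinsFrom H enforcer q.other A (insert u F) := by
  -- The second conjunct looks one pick of Avoider ahead. It is needed when Enforcer's planned move
  -- `y` comes only after Avoider's pick `x`.
  suffices WinsFrom H enforcer q.other A (insert u F) ∧ (q = avoider → ∀ x ∈ F,
      WinsFrom H enforcer avoider (insert x A) (insert u (F \ {x}))) from this.1
  induction h with
  | finished q A h =>
    refine ⟨?_, fun _ x hx => hx.elim⟩
    obtain ⟨e, he, hs⟩ := h
    cases q with
    | avoider =>
      refine .ownMove A _ u (Set.mem_insert _ _) ?_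
      rw [Set.insert_sdiff_self_of_notMem hu]
      exact .finished _ _ ⟨e, he, hs⟩
    | enforcer =>
      refine .otherMove A _ ⟨u, Set.mem_insert _ _⟩ fun v hv => ?_
      obtain rfl : v = u := by simpa using hv
      rw [Set.insert_sdiff_self_of_notMem hu]
      exact .finished _ _ ⟨e, he, hs.trans (Set.subset_insert _ _)⟩
  | ownMove A F y hy h ih =>
    -- If Avoider picks `u`, Enforcer resumes the old strategy; if Avoider picks the planned `y`,
    -- Enforcer picks `u` instead; otherwise Enforcer picks `y` and keeps `u` as the spare vertex.
    refine ⟨.otherMove A _ ⟨u, Set.mem_insert _ _⟩ fun x hx => ?_, fun h => nomatch h⟩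
    by_cases hxu : x = u
    · subst hxu
      rw [Set.insert_sdiff_self_of_notMem hu]
      exact (WinsFrom.ownMove A F y hy h).enforcer_mono (Set.subset_insert _ _)
    have hxF : x ∈ F := hx.resolve_left hxu
    by_cases hxy : x = y
    · subst hxy
      refine .ownMove _ _ u ⟨Set.mem_insert _ _, Ne.symm hxu⟩ ?_
      have e : (insert u F \ {x}) \ {u} = F \ {x} := by
        ext z; simp only [Set.mem_sdiff, Set.mem_insert_iff, Set.mem_singleton_iff]; grind
      rw [e]
      exact h.enforcer_mono (Set.subset_insert _ _)
    · refine .ownMove _ _ y ⟨Set.mem_insert_of_mem _ hy, Ne.symm hxy⟩ ?_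
      have e : (insert u F \ {x}) \ {y} = insert u ((F \ {y}) \ {x}) := by
        ext z; simp only [Set.mem_sdiff, Set.mem_insert_iff, Set.mem_singleton_iff]; grind
      rw [e]
      exact (ih fun h => hu h.1).2 rfl x ⟨hxF, hxy⟩
  | otherMove A F hF h ih =>
    refine ⟨.ownMove A _ u (Set.mem_insert _ _) ?_, fun _ x hx => ?_⟩
    · rw [Set.insert_sdiff_self_of_notMem hu]
      exact .otherMove A F hF h
    · exact (ih x hx fun h => hu h.1).1

/-- A win of Enforcer on a part of the board extends to the whole board, if the same player
remains the last one. -/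
theorem WinsFrom.enforcer_extend {V : Type*} [Finite V] {H : Hypergraph V} {A S T : Set V}
    {l : Player}
    (h : WinsFrom H enforcer (if Odd S.ncard then l else l.other) A S) (hST : S ⊆ T) :
    WinsFrom H enforcer (if Odd T.ncard then l else l.other) A T := by
  have key : ∀ R : Set V, Disjoint R S →
      WinsFrom H enforcer (if Odd (R ∪ S).ncard then l else l.other) A (R ∪ S) := by
    intro R
    induction R, Set.toFinite R using Set.Finite.induction_on with
    | empty => intro _; simpa using h
    | @insert a R ha _ ih =>
      intro hd
      rw [Set.disjoint_insert_left] at hd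
      have hn : a ∉ R ∪ S := by simp [ha, hd.1]
      have := (ih hd.2).enforcer_insert hn
      rw [Set.insert_union, Set.ncard_insert_of_notMem hn]
      convert this using 1
      cases l <;> by_cases ho : Odd (R ∪ S).ncard <;>
        simp [Nat.odd_add_one, ho, Player.other]
  simpa [Set.sdiff_union_of_subset hST] using key (T \ S) Set.disjoint_sdiff_left

/-! ### Enforcer's strategies on the small patterns -/

theorem winsFrom_enforcer_of_adj {V : Type*} [Finite V] {G : SimpleGraph V} {A : Set V} {x y : V}
    (hx : x ∈ A) (hy : y ∈ A) (h : G.Adj x y) (q : Player) (F : Set V) :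
    WinsFrom (graphHypergraph G) enforcer q A F := by
  have h0 : ∀ q, WinsFrom (graphHypergraph G) enforcer q A ∅ := fun q =>
    .finished q A ⟨_, ⟨x, y, h, rfl⟩, by simp [Set.insert_subset_iff, hx, hy]⟩
  have := fun l => WinsFrom.enforcer_extend (T := F) (l := l) (h0 _) (Set.empty_subset _)
  by_cases ho : Odd F.ncard
  · simpa [ho] using this q
  · cases q with
    | avoider => simpa [ho, Player.other] using this enforcer
    | enforcer => simpa [ho, Player.other] using this avoider

/-- Avoider is to move, and all vertices that are left are adjacent to a vertex of Avoider. -/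
theorem winsFrom_enforcer_of_dead {V : Type*} [Finite V] {G : SimpleGraph V} {A F : Set V}
    (hF : F.Nonempty) (h : ∀ v ∈ F, ∃ a ∈ A, G.Adj a v) :
    WinsFrom (graphHypergraph G) enforcer avoider A F := by
  refine .otherMove A F hF fun v hv => ?_
  obtain ⟨a, ha, hav⟩ := h v hv
  exact winsFrom_enforcer_of_adj (Set.mem_insert_of_mem _ ha) (Set.mem_insert _ _) hav _ _

/-- A round consisting of a pick of Avoider and an answer of Enforcer. -/
theorem WinsFrom.enforcer_round {V : Type*} {H : Hypergraph V} {A F : Set V} (hF : F.Nonempty)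
    (h : ∀ v ∈ F, ∃ w ∈ F, w ≠ v ∧ WinsFrom H enforcer avoider (insert v A) (F \ {v, w})) :
    WinsFrom H enforcer avoider A F := by
  refine .otherMove A F hF fun v hv => ?_
  obtain ⟨w, hw, hwv, hwin⟩ := h v hv
  refine .ownMove _ _ w ⟨hw, hwv⟩ ?_
  rw [Set.sdiff_sdiff, Set.singleton_union]
  exact hwin

theorem winsFrom_enforcer_path {V : Type*} [Finite V] {G : SimpleGraph V} {A : Set V} {x y z : V}
    (hxz : x ≠ z) (hxy : G.Adj x y) (hyz : G.Adj y z) :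
    WinsFrom (graphHypergraph G) enforcer avoider A {x, y, z} := by
  have h1 := hxy.ne
  have h2 := hyz.ne
  refine WinsFrom.enforcer_round (by simp) fun v hv => ?_
  rcases hv with rfl | rfl | rfl
  · refine ⟨z, by simp, hxz.symm, winsFrom_enforcer_of_dead ⟨y, by grind⟩ fun w hw => ?_⟩
    exact ⟨v, by simp, by grind⟩
  · refine ⟨z, by simp, h2.symm, winsFrom_enforcer_of_dead ⟨x, by grind⟩ fun w hw => ?_⟩
    exact ⟨v, by simp, by grind [G.adj_comm]⟩
  · refine ⟨x, by simp, hxz, winsFrom_enforcer_of_dead ⟨y, by grind⟩ fun w hw => ?_⟩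
    exact ⟨v, by simp, by grind [G.adj_comm]⟩

/-- The dead vertex `d` is no use to Avoider, and any pick on the path lets Enforcer leave `d` and a
neighbour of that pick, both dead. -/
theorem winsFrom_enforcer_dead_path {V : Type*} [Finite V] {G : SimpleGraph V} {A : Set V}
    {a d x y z : V} (ha : a ∈ A) (had : G.Adj a d) (hdx : d ≠ x) (hdy : d ≠ y) (hdz : d ≠ z)
    (hxz : x ≠ z) (hxy : G.Adj x y) (hyz : G.Adj y z) :
    WinsFrom (graphHypergraph G) enforcer avoider A {d, x, y, z} := by
  have h1 := hxy.ne
  have h2 := hyz.ne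
  refine WinsFrom.enforcer_round (by simp) fun v hv => ?_
  rcases hv with rfl | rfl | rfl | rfl
  · exact ⟨x, by simp, hdx.symm, winsFrom_enforcer_of_adj (Set.mem_insert_of_mem _ ha)
      (Set.mem_insert _ _) had _ _⟩
  · refine ⟨z, by simp, hxz.symm, winsFrom_enforcer_of_dead ⟨y, by grind⟩ fun w hw => ?_⟩
    by_cases hwd : w = d
    · exact ⟨a, by simp [ha], hwd ▸ had⟩
    · exact ⟨v, by simp, by grind⟩
  · refine ⟨z, by simp, h2.symm, winsFrom_enforcer_of_dead ⟨x, by grind⟩ fun w hw => ?_⟩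
    by_cases hwd : w = d
    · exact ⟨a, by simp [ha], hwd ▸ had⟩
    · exact ⟨v, by simp, by grind [G.adj_comm]⟩
  · refine ⟨x, by simp, hxz, winsFrom_enforcer_of_dead ⟨y, by grind⟩ fun w hw => ?_⟩
    by_cases hwd : w = d
    · exact ⟨a, by simp [ha], hwd ▸ had⟩
    · exact ⟨v, by simp, by grind [G.adj_comm]⟩

theorem winsFrom_enforcer_cycle {V : Type*} [Finite V] {G : SimpleGraph V} {f : Fin 4 → V}
    (hf : Function.Injective f) (h01 : G.Adj (f 0) (f 1)) (h12 : G.Adj (f 1) (f 2))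
    (h23 : G.Adj (f 2) (f 3)) (h30 : G.Adj (f 3) (f 0)) (A : Set V) :
    WinsFrom (graphHypergraph G) enforcer avoider A (Set.range f) := by
  refine WinsFrom.enforcer_round (Set.range_nonempty f) ?_
  rintro _ ⟨i, rfl⟩
  -- Enforcer takes the opposite vertex; the two vertices left are neighbours of the pick.
  refine ⟨f (i + 2), by simp, hf.ne (by decide +revert), winsFrom_enforcer_of_dead
    ⟨f (i + 1), by simp [hf.eq_iff]⟩ ?_⟩
  rintro _ ⟨⟨j, rfl⟩, hj⟩
  refine ⟨f i, by simp, ?_⟩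
  have := h01.symm; have := h12.symm; have := h23.symm; have := h30.symm
  simp only [Set.mem_insert_iff, Set.mem_singleton_iff, hf.eq_iff] at hj
  fin_cases i <;> fin_cases j <;> first | assumption | simp at hj

/-- Enforcer answers in the same path so that its remaining vertex is dead, which leaves a dead
vertex and an intact path. -/
theorem winsFrom_enforcer_two_paths {V : Type*} [Finite V] {G : SimpleGraph V}
    {a b c x y z : V} (hn : [a, b, c, x, y, z].Nodup)
    (hab : G.Adj a b) (hbc : G.Adj b c) (hxy : G.Adj x y) (hyz : G.Adj y z) (A : Set V) :
    WinsFrom (graphHypergraph G) enforcer avoider A {a, b, c, x, y, z} := by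
  have key : ∀ {a b c x y z : V}, [a, b, c, x, y, z].Nodup → G.Adj a b → G.Adj b c → G.Adj x y →
      G.Adj y z → ∀ v ∈ ({a, b, c} : Set V), ∃ w ∈ ({a, b, c, x, y, z} : Set V), w ≠ v ∧
      WinsFrom (graphHypergraph G) enforcer avoider (insert v A)
        (({a, b, c, x, y, z} : Set V) \ {v, w}) := by
    intro a b c x y z hn hab hbc hxy hyz v hv
    simp only [List.nodup_cons, List.mem_cons, List.not_mem_nil, or_false, not_or] at hn
    rcases hv with rfl | rfl | rfl
    · refine ⟨c, by simp, by grind, ?_⟩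
      have e : ({v, b, c, x, y, z} : Set V) \ {v, c} = {b, x, y, z} := by ext; grind
      rw [e]
      apply winsFrom_enforcer_dead_path (Set.mem_insert _ _) hab <;> grind
    · refine ⟨c, by simp, by grind, ?_⟩
      have e : ({a, v, c, x, y, z} : Set V) \ {v, c} = {a, x, y, z} := by ext; grind
      rw [e]
      apply winsFrom_enforcer_dead_path (Set.mem_insert _ _) hab.symm <;> grind
    · refine ⟨a, by simp, by grind, ?_⟩
      have e : ({a, b, v, x, y, z} : Set V) \ {v, a} = {b, x, y, z} := by ext; grind
      rw [e]
      apply winsFrom_enforcer_dead_path (Set.mem_insert _ _) hbc.symm <;> grind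
  refine WinsFrom.enforcer_round (by simp) fun v hv => ?_
  by_cases h : v ∈ ({a, b, c} : Set V)
  · exact key hn hab hbc hxy hyz v h
  · have e : ({a, b, c, x, y, z} : Set V) = {x, y, z, a, b, c} := by clear key; ext; grind
    rw [e] at hv ⊢
    refine key ?_ hxy hyz hab hbc v (by clear key; grind)
    simp only [List.nodup_cons, List.mem_cons, List.not_mem_nil, or_false, not_or] at hn ⊢
    clear key
    grind

theorem winsFrom_enforcer_sunlet {V : Type*} [Finite V] {G : SimpleGraph V}
    {a b c x y z : V} (hn : [a, b, c, x, y, z].Nodup) (hab : G.Adj a b) (hbc : G.Adj b c)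
    (hca : G.Adj c a) (hax : G.Adj a x) (hby : G.Adj b y) (hcz : G.Adj c z) (A : Set V) :
    WinsFrom (graphHypergraph G) enforcer avoider A {a, b, c, x, y, z} := by
  have key : ∀ {a b c x y z : V}, [a, b, c, x, y, z].Nodup → G.Adj a b → G.Adj b c → G.Adj c a →
      G.Adj a x → G.Adj b y → G.Adj c z → ∀ v ∈ ({a, x} : Set V),
      ∃ w ∈ ({a, b, c, x, y, z} : Set V), w ≠ v ∧
      WinsFrom (graphHypergraph G) enforcer avoider (insert v A)
        (({a, b, c, x, y, z} : Set V) \ {v, w}) := by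
    intro a b c x y z hn hab hbc hca hax hby hcz v hv
    simp only [List.nodup_cons, List.mem_cons, List.not_mem_nil, or_false, not_or] at hn
    have hac := hca.symm
    rcases hv with rfl | rfl
    -- After a triangle vertex, Enforcer removes its leaf: the other two triangle vertices are dead,
    -- and Avoider can take only one of the leaves `y`, `z` before Enforcer takes the other.
    · refine ⟨x, by simp, by grind, ?_⟩
      have e : ({v, b, c, x, y, z} : Set V) \ {v, x} = {b, c, y, z} := by ext; grind
      rw [e]
      refine WinsFrom.enforcer_round (by simp) ?_
      rintro w (rfl | rfl | rfl | rfl)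
      · exact ⟨c, by simp, by grind, winsFrom_enforcer_of_adj (x := v) (by simp)
          (Set.mem_insert _ _) hab _ _⟩
      · exact ⟨b, by simp, by grind, winsFrom_enforcer_of_adj (x := v) (by simp)
          (Set.mem_insert _ _) hac _ _⟩
      · refine ⟨z, by simp, by grind, winsFrom_enforcer_of_dead ⟨b, by grind⟩ ?_⟩
        exact fun u hu => ⟨v, by simp, by grind⟩
      · refine ⟨y, by simp, by grind, winsFrom_enforcer_of_dead ⟨b, by grind⟩ ?_⟩
        exact fun u hu => ⟨v, by simp, by grind⟩
    -- After a leaf, its neighbour `a` is dead; removing `z` leaves `a` and the path `y`, `b`, `c`.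
    · refine ⟨z, by simp, by grind, ?_⟩
      have e : ({a, b, c, v, y, z} : Set V) \ {v, z} = {a, y, b, c} := by ext; grind
      rw [e]
      apply winsFrom_enforcer_dead_path (Set.mem_insert _ _) hax.symm (hxy := hby.symm)
        (hyz := hbc) <;> grind
  refine WinsFrom.enforcer_round (by simp) fun v hv => ?_
  have hn' := hn
  simp only [List.nodup_cons, List.mem_cons, List.not_mem_nil, or_false, not_or] at hn'
  have h : v ∈ ({a, x} : Set V) ∨ v ∈ ({b, y} : Set V) ∨ v ∈ ({c, z} : Set V) := by
    clear key
    grind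
  rcases h with h | h | h
  · exact key hn hab hbc hca hax hby hcz v h
  · have e : ({a, b, c, x, y, z} : Set V) = {b, c, a, y, z, x} := by clear key; ext; grind
    rw [e]
    refine key ?_ hbc hca hab hby hcz hax v h
    simp only [List.nodup_cons, List.mem_cons, List.not_mem_nil, or_false, not_or]
    clear key
    grind
  · have e : ({a, b, c, x, y, z} : Set V) = {c, a, b, z, x, y} := by clear key; ext; grind
    rw [e]
    refine key ?_ hca hab hbc hcz hax hby v h
    simp only [List.nodup_cons, List.mem_cons, List.not_mem_nil, or_false, not_or]
    clear key
    grind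

/-! ### Perfect matchings and explicit forms of containment -/

theorem even_ncard_of_existsUnique_adj {V : Type*} [Finite V] {G : SimpleGraph V} {S : Set V}
    (h : ∀ v ∈ S, ∃! w, w ∈ S ∧ G.Adj v w) : Even S.ncard := by
  classical
  have := Fintype.ofFinite V
  have hM : ((⊤ : G.Subgraph).induce S).IsMatching := by
    intro v hv
    have hv' : v ∈ S := hv
    simpa [hv'] using h v hv'
  have := hM.even_card
  rwa [← Set.ncard_eq_toFinset_card'] at this

theorem isContained_pathGraph_iff {V : Type*} {G : SimpleGraph V} :
    (SimpleGraph.pathGraph 3).IsContained G ↔ ∃ x y z, x ≠ z ∧ G.Adj x y ∧ G.Adj y z := by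
  constructor
  · rintro ⟨f⟩
    exact ⟨f 0, f 1, f 2, f.injective.ne (by decide),
      f.toHom.map_adj (by simp [SimpleGraph.pathGraph_adj]),
      f.toHom.map_adj (by simp [SimpleGraph.pathGraph_adj])⟩
  · rintro ⟨x, y, z, hxz, hxy, hyz⟩
    refine ⟨⟨⟨![x, y, z], ?_⟩, ?_⟩⟩
    · intro i j hij
      rw [SimpleGraph.pathGraph_adj] at hij
      fin_cases i <;> fin_cases j <;> simp_all [G.adj_comm]
    · have := hxy.ne
      have := hyz.ne
      intro i j hij
      fin_cases i <;> fin_cases j <;> simp_all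

theorem isContained_cycleGraph_iff {V : Type*} {G : SimpleGraph V} :
    (SimpleGraph.cycleGraph 4).IsContained G ↔ ∃ a b c d, a ≠ c ∧ b ≠ d ∧
      G.Adj a b ∧ G.Adj b c ∧ G.Adj c d ∧ G.Adj d a := by
  constructor
  · rintro ⟨f⟩
    exact ⟨f 0, f 1, f 2, f 3, f.injective.ne (by decide), f.injective.ne (by decide),
      f.toHom.map_adj (by decide),
      f.toHom.map_adj (by decide),
      f.toHom.map_adj (by decide),
      f.toHom.map_adj (by decide)⟩
  · rintro ⟨a, b, c, d, hac, hbd, hab, hbc, hcd, hda⟩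
    refine ⟨⟨⟨![a, b, c, d], ?_⟩, ?_⟩⟩
    · intro i j hij
      have := hab.symm; have := hbc.symm; have := hcd.symm; have := hda.symm
      fin_cases i <;> fin_cases j <;> first | assumption | exact absurd hij (by decide)
    · have := hab.ne; have := hbc.ne; have := hcd.ne; have := hda.ne
      intro i j hij
      fin_cases i <;> fin_cases j <;> simp_all

theorem isContained_twoP3_iff {V : Type*} {G : SimpleGraph V} :
    twoP3.IsContained G ↔ ∃ a b c x y z, [a, b, c, x, y, z].Nodup ∧
      G.Adj a b ∧ G.Adj b c ∧ G.Adj x y ∧ G.Adj y z := by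
  constructor
  · rintro ⟨f⟩
    refine ⟨f (.inl 0), f (.inl 1), f (.inl 2), f (.inr 0), f (.inr 1), f (.inr 2), ?_,
      f.toHom.map_adj (by simp [twoP3, SimpleGraph.pathGraph_adj]),
      f.toHom.map_adj (by simp [twoP3, SimpleGraph.pathGraph_adj]),
      f.toHom.map_adj (by simp [twoP3, SimpleGraph.pathGraph_adj]),
      f.toHom.map_adj (by simp [twoP3, SimpleGraph.pathGraph_adj])⟩
    exact List.Nodup.map f.injective (l := [.inl 0, .inl 1, .inl 2, .inr 0, .inr 1, .inr 2])
      (by decide)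
  · rintro ⟨a, b, c, x, y, z, hn, hab, hbc, hxy, hyz⟩
    simp only [List.nodup_cons, List.mem_cons, List.not_mem_nil, or_false, not_or] at hn
    refine ⟨⟨⟨Sum.elim ![a, b, c] ![x, y, z], ?_⟩, ?_⟩⟩
    · have := hab.symm; have := hbc.symm; have := hxy.symm; have := hyz.symm
      rintro (i | i) (j | j) hij <;> simp only [twoP3, SimpleGraph.sum_adj,
        SimpleGraph.pathGraph_adj] at hij <;>
        fin_cases i <;> fin_cases j <;> first | assumption | simp at hij
    · rintro (i | i) (j | j) hij <;> fin_cases i <;> fin_cases j <;> simp_all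

theorem isContained_sunlet3_iff {V : Type*} {G : SimpleGraph V} :
    sunlet3.IsContained G ↔ ∃ a b c x y z, [a, b, c, x, y, z].Nodup ∧
      G.Adj a b ∧ G.Adj b c ∧ G.Adj c a ∧ G.Adj a x ∧ G.Adj b y ∧ G.Adj c z := by
  constructor
  · rintro ⟨f⟩
    refine ⟨f (.inl 0), f (.inl 1), f (.inl 2), f (.inr 0), f (.inr 1), f (.inr 2), ?_,
      f.toHom.map_adj (by simp [sunlet3]),
      f.toHom.map_adj (by simp [sunlet3]),
      f.toHom.map_adj (by simp [sunlet3]),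
      f.toHom.map_adj (by simp [sunlet3]),
      f.toHom.map_adj (by simp [sunlet3]),
      f.toHom.map_adj (by simp [sunlet3])⟩
    exact List.Nodup.map f.injective (l := [.inl 0, .inl 1, .inl 2, .inr 0, .inr 1, .inr 2])
      (by decide)
  · rintro ⟨a, b, c, x, y, z, hn, hab, hbc, hca, hax, hby, hcz⟩
    simp only [List.nodup_cons, List.mem_cons, List.not_mem_nil, or_false, not_or] at hn
    refine ⟨⟨⟨Sum.elim ![a, b, c] ![x, y, z], ?_⟩, ?_⟩⟩
    · have := hab.symm; have := hbc.symm; have := hca.symm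
      have := hax.symm; have := hby.symm; have := hcz.symm
      rintro (i | i) (j | j) hij <;> simp only [sunlet3] at hij <;>
        fin_cases i <;> fin_cases j <;> first | assumption | simp at hij
    · rintro (i | i) (j | j) hij <;> fin_cases i <;> fin_cases j <;> simp_all

/-! ### Graphs without forbidden subgraphs: a vertex meeting all `P₃` -/

section Structure

variable {W : Type*} {G : SimpleGraph W}

theorem not_disjoint_paths (hG : ¬ twoP3.IsContained G) {a b c x y z : W} (hac : a ≠ c)
    (hxz : x ≠ z) (hab : G.Adj a b) (hbc : G.Adj b c) (hxy : G.Adj x y) (hyz : G.Adj y z) :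
    a = x ∨ a = y ∨ a = z ∨ b = x ∨ b = y ∨ b = z ∨ c = x ∨ c = y ∨ c = z := by
  by_contra h
  refine hG (isContained_twoP3_iff.2 ⟨a, b, c, x, y, z, ?_, hab, hbc, hxy, hyz⟩)
  have := hab.ne; have := hbc.ne; have := hxy.ne; have := hyz.ne
  simp only [List.nodup_cons, List.mem_cons, List.not_mem_nil, or_false, not_or]
  simp only [not_or] at h
  tauto

theorem not_four_cycle (hG : ¬ (SimpleGraph.cycleGraph 4).IsContained G) {a b c d : W}
    (hac : a ≠ c) (hbd : b ≠ d) (hab : G.Adj a b) (hbc : G.Adj b c) (hcd : G.Adj c d)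
    (hda : G.Adj d a) : False :=
  hG (isContained_cycleGraph_iff.2 ⟨a, b, c, d, hac, hbd, hab, hbc, hcd, hda⟩)

/-- If `G` has no `2P₃` and no isolated vertices, then what remains of `G` outside of a union of
components containing a `P₃` is perfectly matched. -/
theorem even_ncard_compl [Finite W] (hG : ¬ twoP3.IsContained G)
    (hiso : ∀ v, ∃ w, G.Adj v w) {S : Set W} (hS : ∀ s ∈ S, ∀ v ∉ S, ¬ G.Adj s v) {x y z : W}
    (hx : x ∈ S) (hy : y ∈ S) (hz : z ∈ S) (hxz : x ≠ z) (hxy : G.Adj x y) (hyz : G.Adj y z) :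
    Even Sᶜ.ncard := by
  refine even_ncard_of_existsUnique_adj (G := G) fun v hv => ?_
  obtain ⟨w, hw⟩ := hiso v
  have hc : ∀ u, G.Adj v u → u ∉ S := fun u hu h => hS u h v hv hu.symm
  refine ⟨w, ⟨hc w hw, hw⟩, fun u hu => ?_⟩
  by_contra hne
  have := not_disjoint_paths hG hne hxz hu.2.symm hw hxy hyz
  have := hc w hw
  have := hu.1
  simp only [Set.mem_compl_iff] at *
  -- Two distinct neighbours of `v` would form with it a `P₃` outside `S`, disjoint from `x`, `y`,
  -- `z`.
  grind

/-- A graph of even order without isolated vertices and without `2P₃` has no component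
of order five. -/
theorem exists_adj_of_ncard_eq_five [Finite W] (hG : ¬ twoP3.IsContained G)
    (hiso : ∀ v, ∃ w, G.Adj v w) (heven : Even (Nat.card W)) {S : Set W} (hcard : S.ncard = 5)
    {x y z : W} (hx : x ∈ S) (hy : y ∈ S) (hz : z ∈ S) (hxz : x ≠ z) (hxy : G.Adj x y)
    (hyz : G.Adj y z) : ∃ s ∈ S, ∃ v ∉ S, G.Adj s v := by
  by_contra! h
  have h1 := even_ncard_compl hG hiso h hx hy hz hxz hxy hyz
  have h2 := Set.ncard_add_ncard_compl S
  grind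

theorem ncard_eq_five {a b c d e : W} (h : [a, b, c, d, e].Nodup) :
    ({a, b, c, d, e} : Set W).ncard = 5 := by
  simp only [List.nodup_cons, List.mem_cons, List.not_mem_nil, or_false, not_or] at h
  rw [Set.ncard_insert_of_notMem, Set.ncard_insert_of_notMem, Set.ncard_insert_of_notMem,
    Set.ncard_pair] <;> simp <;> tauto

/-- By parity some edge leaves the cycle. With the next cycle edge it forms a `P₃`, and the other
three cycle vertices form a second one. -/
theorem not_five_cycle [Finite W] (hG : ¬ twoP3.IsContained G) (hiso : ∀ v, ∃ w, G.Adj v w)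
    (heven : Even (Nat.card W)) {a b c d e : W} (hn : [a, b, c, d, e].Nodup) (hab : G.Adj a b)
    (hbc : G.Adj b c) (hcd : G.Adj c d) (hde : G.Adj d e) : ¬ G.Adj e a := by
  intro hea
  obtain ⟨s, hs, v, hv, hsv⟩ := exists_adj_of_ncard_eq_five hG hiso heven (ncard_eq_five hn)
    (x := a) (y := b) (z := c) (by simp) (by simp) (by simp) (by grind) hab hbc
  simp only [List.nodup_cons, List.mem_cons, List.not_mem_nil, or_false, not_or] at hn
  simp only [Set.mem_insert_iff, Set.mem_singleton_iff, not_or] at hv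
  rcases hs with rfl | rfl | rfl | rfl | rfl
  · have := not_disjoint_paths hG (by grind) (by grind) hsv.symm hab hcd hde
    grind
  · have := not_disjoint_paths hG (by grind) (by grind) hsv.symm hbc hde hea
    grind
  · have := not_disjoint_paths hG (by grind) (by grind) hsv.symm hcd hea hab
    grind
  · have := not_disjoint_paths hG (by grind) (by grind) hsv.symm hde hab hbc
    grind
  · have := not_disjoint_paths hG (by grind) (by grind) hsv.symm hea hbc hcd
    grind

/-- By parity some edge leaves the bull: at the third triangle vertex it completes a 3-sunlet,
anywhere else it produces `2P₃`. -/
theorem not_bull [Finite W] (hG : ¬ ContainsForbidden G) (hiso : ∀ v, ∃ w, G.Adj v w)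
    (heven : Even (Nat.card W)) {a b c x y : W} (hn : [a, b, c, x, y].Nodup) (hab : G.Adj a b)
    (hbc : G.Adj b c) (hca : G.Adj c a) (hax : G.Adj a x) : ¬ G.Adj b y := by
  intro hby
  simp only [ContainsForbidden, not_or] at hG
  obtain ⟨h2, h4, h3⟩ := hG
  obtain ⟨s, hs, v, hv, hsv⟩ := exists_adj_of_ncard_eq_five h2 hiso heven (ncard_eq_five hn)
    (x := a) (y := b) (z := c) (by simp) (by simp) (by simp) (by grind) hab hbc
  simp only [List.nodup_cons, List.mem_cons, List.not_mem_nil, or_false, not_or] at hn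
  simp only [Set.mem_insert_iff, Set.mem_singleton_iff, not_or] at hv
  rcases hs with rfl | rfl | rfl | rfl | rfl
  · have := not_disjoint_paths h2 (by grind) (by grind) hsv.symm hax hbc.symm hby
    grind
  · have := not_disjoint_paths h2 (by grind) (by grind) hsv.symm hby hca hax
    grind
  · refine h3 (isContained_sunlet3_iff.2 ⟨a, b, s, x, y, v, ?_, hab, hbc, hca, hax, hby, hsv⟩)
    simp only [List.nodup_cons, List.mem_cons, List.not_mem_nil, or_false, not_or]
    grind
  · have := not_disjoint_paths h2 (by grind) (by grind) hsv.symm hax.symm hbc.symm hby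
    grind
  · have := not_disjoint_paths h2 (by grind) (by grind) hsv.symm hby.symm hca hax
    grind

/-- The vertex `c` meets all the paths on three vertices in `G`. -/
def MeetsPaths (G : SimpleGraph W) (c : W) : Prop :=
  ∀ x y z, x ≠ c → y ≠ c → z ≠ c → G.Adj x y → G.Adj y z → x = z

/-- Any `P₃` meets the triangle, but once `a` is removed, `b` and `c` form a component with a single
edge. -/
theorem meetsPaths_of_triangle (hG : ¬ twoP3.IsContained G) {a b c : W} (hab : G.Adj a b)
    (hbc : G.Adj b c) (hca : G.Adj c a) (hb : ∀ v, G.Adj b v → v = a ∨ v = c)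
    (hc : ∀ v, G.Adj c v → v = a ∨ v = b) : MeetsPaths G a := by
  intro x y z hx hy hz hxy hyz
  by_contra hxz
  have := not_disjoint_paths hG hca.ne.symm hxz hab hbc hxy hyz
  have := hxy.symm
  have := hyz.symm
  grind [SimpleGraph.irrefl]

theorem exists_meetsPaths_of_triangle [Finite W] (hG : ¬ ContainsForbidden G)
    (hiso : ∀ v, ∃ w, G.Adj v w) (heven : Even (Nat.card W)) {a b c : W} (hab : G.Adj a b)
    (hbc : G.Adj b c) (hca : G.Adj c a) : ∃ c, MeetsPaths G c := by
  have hG' := hG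
  simp only [ContainsForbidden, not_or] at hG'
  obtain ⟨h2, h4, -⟩ := hG'
  -- At most one triangle vertex has neighbours outside the triangle: two of them would yield a `C₄`
  -- if they share such a neighbour, and a bull otherwise.
  have key : ∀ {a b c x y : W}, G.Adj a b → G.Adj b c → G.Adj c a → G.Adj a x → G.Adj b y →
      x ≠ b → x ≠ c → y ≠ a → y ≠ c → False := by
    intro a b c x y hab hbc hca hax hby hxb hxc hya hyc
    have := hab.ne; have := hbc.ne; have := hca.ne; have := hax.ne; have := hby.ne
    by_cases hxy : x = y
    · subst hxy
      exact not_four_cycle h4 (by grind) (by grind) hax hby.symm hbc hca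
    · refine not_bull hG hiso heven ?_ hab hbc hca hax hby
      simp only [List.nodup_cons, List.mem_cons, List.not_mem_nil, or_false, not_or]
      grind
  by_cases hb : ∀ v, G.Adj b v → v = a ∨ v = c
  · by_cases hc : ∀ v, G.Adj c v → v = a ∨ v = b
    · exact ⟨a, meetsPaths_of_triangle h2 hab hbc hca hb hc⟩
    · push Not at hc
      obtain ⟨x, hcx, hxa, hxb⟩ := hc
      refine ⟨c, meetsPaths_of_triangle h2 hca hab hbc (fun v hv => ?_) fun v hv => ?_⟩
      · by_contra! h
        exact key hca hab hbc hcx hv hxa hxb h.1 h.2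
      · exact (hb v hv).symm
  · push Not at hb
    obtain ⟨x, hbx, hxa, hxc⟩ := hb
    refine ⟨b, meetsPaths_of_triangle h2 hbc hca hab (fun v hv => ?_) fun v hv => ?_⟩
    · by_contra! h
      exact key hbc hca hab hbx hv hxc hxa h.1 h.2
    · by_contra! h
      exact key hab.symm hca.symm hbc.symm hbx hv hxa hxc h.1 h.2

/-- The path is induced. A `P₃` avoiding `c` must meet both `{a, b}` and `{d, e}`, since it meets
the halves `abc` and `cde`; so its middle vertex would be a common neighbour of the two pairs, which
creates a `C₄` or `2P₃`. -/
theorem meetsPaths_of_five_path [Finite W] (hG : ¬ ContainsForbidden G)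
    (hiso : ∀ v, ∃ w, G.Adj v w) (heven : Even (Nat.card W))
    (htri : ∀ a b c, G.Adj a b → G.Adj b c → ¬ G.Adj c a) {a b c d e : W}
    (hn : [a, b, c, d, e].Nodup) (hab : G.Adj a b) (hbc : G.Adj b c) (hcd : G.Adj c d)
    (hde : G.Adj d e) : MeetsPaths G c := by
  simp only [ContainsForbidden, not_or] at hG
  obtain ⟨h2, h4, -⟩ := hG
  have hae : ¬ G.Adj e a := not_five_cycle h2 hiso heven hn hab hbc hcd hde
  simp only [List.nodup_cons, List.mem_cons, List.not_mem_nil, or_false, not_or] at hn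
  have hbd : ¬ G.Adj d b := htri b c d hbc hcd
  have had : ¬ G.Adj d a := fun h => not_four_cycle h4 (by grind) (by grind) hab hbc hcd h
  have hbe : ¬ G.Adj e b := fun h => not_four_cycle h4 (by grind) (by grind) hbc hcd hde h
  have had' : ¬ G.Adj a d := fun h => had h.symm
  have hbe' : ¬ G.Adj b e := fun h => hbe h.symm
  have hbd' : ¬ G.Adj b d := fun h => hbd h.symm
  have hae' : ¬ G.Adj a e := fun h => hae h.symm
  have nbd : ∀ t, t ≠ c → G.Adj b t → ¬ G.Adj d t := fun t ht h1 h2 =>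
    not_four_cycle h4 (by grind) ht h1 h2.symm hcd.symm hbc.symm
  have nad : ∀ t, t ≠ c → G.Adj a t → ¬ G.Adj d t := by
    intro t ht h1 h3
    have := not_disjoint_paths h2 (by grind) (by grind) h1.symm hab hcd hde
    grind [SimpleGraph.irrefl]
  have nbe : ∀ t, t ≠ c → G.Adj b t → ¬ G.Adj e t := by
    intro t ht h1 h3
    have := not_disjoint_paths h2 (by grind) (by grind) h3.symm hde.symm hab hbc
    grind [SimpleGraph.irrefl]
  have nae : ∀ t, t ≠ c → G.Adj a t → ¬ G.Adj e t := by
    intro t ht h1 h3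
    have := not_disjoint_paths h2 (by grind) (by grind) h1.symm hab hcd hde
    grind [SimpleGraph.irrefl]
  intro x y z hx hy hz hxy hyz
  by_contra hxz
  have m1 := not_disjoint_paths h2 hxz (by grind) hxy hyz hab hbc
  have m2 := not_disjoint_paths h2 hxz (by grind) hxy hyz hcd hde
  have := hxy.symm
  have := hyz.symm
  clear htri hiso heven h2 h4
  rcases m1 with rfl | rfl | rfl | rfl | rfl | rfl | rfl | rfl | rfl <;> grind

theorem exists_meetsPaths_of_four_path (hG : ¬ twoP3.IsContained G)
    (h4 : ¬ (SimpleGraph.cycleGraph 4).IsContained G)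
    (htri : ∀ a b c, G.Adj a b → G.Adj b c → ¬ G.Adj c a)
    (hpath : ∀ a b c d e, [a, b, c, d, e].Nodup → G.Adj a b → G.Adj b c → G.Adj c d →
      ¬ G.Adj d e) {a b c d : W} (hac : a ≠ c) (hbd : b ≠ d)
    (hab : G.Adj a b) (hbc : G.Adj b c) (hcd : G.Adj c d) : ∃ v, MeetsPaths G v := by
  -- The ends `a` and `d` are leaves. If `c` had only the neighbours `b` and `d`, removing `b` would
  -- isolate `a` and leave `cd` as a component, so `b` would meet all `P₃`.
  have key : ∀ {a b c d : W}, a ≠ c → b ≠ d → G.Adj a b → G.Adj b c → G.Adj c d →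
      ¬ MeetsPaths G b → ∃ p, G.Adj c p ∧ p ≠ b ∧ p ≠ d := by
    intro a b c d hac hbd hab hbc hcd hb
    by_contra! hp
    refine hb fun x y z hx hy hz hxy hyz => ?_
    by_contra hxz
    have had : a ≠ d := fun h => htri a b c hab hbc (h ▸ hcd)
    have := hab.ne; have := hbc.ne; have := hcd.ne
    have hd : ∀ t, G.Adj d t → t = c := by
      intro t ht
      by_contra htc
      have := ht.ne
      by_cases hta : t = a
      · exact not_four_cycle h4 hac hbd hab hbc hcd (hta ▸ ht)
      by_cases htb : t = b
      · exact htri b c d hbc hcd (htb ▸ ht)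
      refine hpath a b c d t ?_ hab hbc hcd ht
      simp only [List.nodup_cons, List.mem_cons, List.not_mem_nil, or_false, not_or]
      grind
    have ha : ∀ t, G.Adj a t → t = b := by
      intro t ht
      by_contra htb
      have := ht.ne
      by_cases htd : t = d
      · exact not_four_cycle h4 hac hbd hab hbc hcd (htd ▸ ht.symm)
      by_cases htc : t = c
      · exact htri a b c hab hbc (htc ▸ ht.symm)
      refine hpath t a b c d ?_ ht.symm hab hbc hcd
      simp only [List.nodup_cons, List.mem_cons, List.not_mem_nil, or_false, not_or]
      grind
    have := not_disjoint_paths hG hxz hac hxy hyz hab hbc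
    have := hxy.symm
    have := hyz.symm
    clear htri hpath hb hG h4
    grind
  by_contra! h
  obtain ⟨p, hcp, hpb, hpd⟩ := key hac hbd hab hbc hcd (h b)
  obtain ⟨q, hbq, hqc, hqa⟩ := key hbd.symm hac.symm hcd.symm hbc.symm hab.symm (h c)
  -- If neither `b` nor `c` works, their extra neighbours give the disjoint paths `q`, `b`, `a` and
  -- `p`, `c`, `d`.
  have := not_disjoint_paths hG hqa hpd hbq.symm hab.symm hcp.symm hcd
  have := htri a b c hab hbc
  have := htri b c d hbc hcd
  have := htri b c p hbc hcp
  have := hbc.ne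
  grind [G.adj_comm]

theorem meetsPaths_of_no_four_path (hG : ¬ twoP3.IsContained G)
    (hpath : ∀ a b c d, a ≠ c → b ≠ d → G.Adj a b → G.Adj b c → ¬ G.Adj c d) {a b c : W}
    (hac : a ≠ c) (hab : G.Adj a b) (hbc : G.Adj b c) : MeetsPaths G b := by
  have ha : ∀ t, G.Adj a t → t = b := fun t ht => by
    by_contra h
    exact hpath t a b c (by grind) hac ht.symm hab hbc
  have hc : ∀ t, G.Adj c t → t = b := fun t ht => by
    by_contra h
    exact hpath a b c t hac (by grind) hab hbc ht
  intro x y z hx hy hz hxy hyz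
  by_contra hxz
  have := not_disjoint_paths hG hxz hac hxy hyz hab hbc
  have := hxy.symm
  have := hyz.symm
  grind

theorem exists_meetsPaths [Finite W] [Nonempty W] (hG : ¬ ContainsForbidden G)
    (hiso : ∀ v, ∃ w, G.Adj v w) (heven : Even (Nat.card W)) : ∃ c, MeetsPaths G c := by
  by_cases htri : ∀ a b c, G.Adj a b → G.Adj b c → ¬ G.Adj c a
  swap
  · push Not at htri
    obtain ⟨a, b, c, hab, hbc, hca⟩ := htri
    exact exists_meetsPaths_of_triangle hG hiso heven hab hbc hca
  by_cases h5 : ∀ a b c d e, [a, b, c, d, e].Nodup → G.Adj a b → G.Adj b c → G.Adj c d →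
      ¬ G.Adj d e
  swap
  · push Not at h5
    obtain ⟨a, b, c, d, e, hn, hab, hbc, hcd, hde⟩ := h5
    exact ⟨c, meetsPaths_of_five_path hG hiso heven htri hn hab hbc hcd hde⟩
  simp only [ContainsForbidden, not_or] at hG
  by_cases hp4 : ∀ a b c d, a ≠ c → b ≠ d → G.Adj a b → G.Adj b c → ¬ G.Adj c d
  swap
  · push Not at hp4
    obtain ⟨a, b, c, d, hac, hbd, hab, hbc, hcd⟩ := hp4
    exact exists_meetsPaths_of_four_path hG.1 hG.2.1 htri h5 hac hbd hab hbc hcd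
  by_cases hp3 : ∃ a b c, a ≠ c ∧ G.Adj a b ∧ G.Adj b c
  · obtain ⟨a, b, c, hac, hab, hbc⟩ := hp3
    exact ⟨b, meetsPaths_of_no_four_path hG.1 hp4 hac hab hbc⟩
  · push Not at hp3
    obtain ⟨c⟩ := ‹Nonempty W›
    refine ⟨c, fun x y z _ _ _ hxy hyz => ?_⟩
    by_contra h
    exact hp3 x y z h hxy hyz

end Structure

/-! ### Avoider's strategies -/

theorem hasWon_avoider_of_independent {V : Type*} {G : SimpleGraph V} {A : Set V}
    (hA : ∀ x ∈ A, ∀ y ∈ A, ¬ G.Adj x y) : HasWon (graphHypergraph G) A avoider := by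
  rintro e ⟨x, y, hxy, rfl⟩ hs
  exact hA x (hs (by simp)) y (hs (by simp)) hxy

/-- A round consisting of a pick of Avoider and an answer of Enforcer, if there is one. -/
theorem WinsFrom.avoider_round {V : Type*} {G : SimpleGraph V} {A F : Set V} {v : V} (hv : v ∈ F)
    (hA : ∀ x ∈ insert v A, ∀ y ∈ insert v A, ¬ G.Adj x y)
    (h : ∀ w ∈ F, w ≠ v → WinsFrom (graphHypergraph G) avoider avoider (insert v A) (F \ {v, w})) :
    WinsFrom (graphHypergraph G) avoider avoider A F := by
  refine .ownMove A F v hv ?_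
  rcases (F \ {v}).eq_empty_or_nonempty with h0 | h0
  · rw [h0]
    exact .finished _ _ (hasWon_avoider_of_independent hA)
  · refine .otherMove _ _ h0 fun w hw => ?_
    rw [Set.sdiff_sdiff, Set.singleton_union]
    exact h w hw.1 hw.2

theorem even_ncard_diff_pair {V : Type*} [Finite V] {F : Set V} {v w : V} (hv : v ∈ F)
    (hw : w ∈ F) (h : w ≠ v) : Even (F \ {v, w}).ncard ↔ Even F.ncard := by
  have h1 := Set.ncard_sdiff_add_ncard_of_subset (s := {v, w}) (t := F)
    (by simp [Set.insert_subset_iff, hv, hw])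
  rw [Set.ncard_pair h.symm] at h1
  rw [← h1]
  simp [parity_simps]

theorem ncard_diff_pair_lt {V : Type*} [Finite V] {F : Set V} {v w : V} (hv : v ∈ F) :
    (F \ {v, w}).ncard < F.ncard :=
  Set.ncard_lt_ncard ⟨Set.sdiff_subset, fun h => (h hv).2 (by simp)⟩

/-- Avoider wins if all but at most one of the vertices that are left are harmless and span a
matching, provided that the number of vertices left is even if there is an exceptional vertex. -/
theorem winsFrom_avoider_of_matching {V : Type*} [Finite V] {G : SimpleGraph V} (A F D : Set V)
    (hA : ∀ x ∈ A, ∀ y ∈ A, ¬ G.Adj x y) (hDF : D ⊆ F) (hD : D.Subsingleton)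
    (heven : D.Nonempty → Even F.ncard) (hAF : ∀ x ∈ A, ∀ y ∈ F \ D, ¬ G.Adj x y)
    (hF : ∀ x ∈ F \ D, ∀ y ∈ F \ D, ∀ z ∈ F \ D, G.Adj x y → G.Adj y z → x = z) :
    WinsFrom (graphHypergraph G) avoider avoider A F := by
  rcases F.eq_empty_or_nonempty with rfl | hne
  · exact .finished _ _ (hasWon_avoider_of_independent hA)
  have hins : ∀ v ∈ F \ D, ∀ x ∈ insert v A, ∀ y ∈ insert v A, ¬ G.Adj x y := by
    rintro v hv x (rfl | hx) y (rfl | hy) hxy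
    · exact hxy.ne rfl
    · exact hAF y hy x hv hxy.symm
    · exact hAF x hx y hv hxy
    · exact hA x hx y hy hxy
  by_cases hsafe : ∃ v ∈ F \ D, ∀ w ∈ F \ D, ¬ G.Adj v w
  · obtain ⟨v, hv, hvw⟩ := hsafe
    -- The pick `v` may be adjacent to the exceptional vertex, which is exempt from the conditions
    -- on `F \ D`.
    refine WinsFrom.avoider_round hv.1 (hins v hv) fun w hw hwv => ?_
    have hsub : (F \ {v, w}) \ (D \ {w}) ⊆ F \ D := by intro u; grind
    have := ncard_diff_pair_lt (w := w) hv.1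
    refine winsFrom_avoider_of_matching (insert v A) (F \ {v, w}) (D \ {w}) (hins v hv) ?_
      (hD.anti Set.sdiff_subset) (fun h => (even_ncard_diff_pair hv.1 hw hwv).2
        (heven (h.mono Set.sdiff_subset))) ?_
      fun x hx y hy z hz => hF x (hsub hx) y (hsub hy) z (hsub hz)
    · rintro u ⟨hu, huw⟩
      refine ⟨hDF hu, ?_⟩
      rintro (rfl | h)
      · exact hv.2 hu
      · exact huw h
    · rintro x (rfl | hx) y hy
      · exact hvw y (hsub hy)
      · exact hAF x hx y (hsub hy)
  · push Not at hsafe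
    have hpar : Even (F \ D).ncard := by
      refine even_ncard_of_existsUnique_adj (G := G) fun v hv => ?_
      obtain ⟨w, hw, hvw⟩ := hsafe v hv
      exact ⟨w, ⟨hw, hvw⟩, fun u hu => hF u hu.1 v hv w hw hu.2.symm hvw⟩
    -- Without a safe vertex `F \ D` is perfectly matched, hence even; an exceptional vertex would
    -- make `F` odd.
    obtain rfl : D = ∅ := by
      by_contra h
      obtain ⟨d, hd⟩ := Set.nonempty_iff_ne_empty.2 h
      have h1 := heven ⟨d, hd⟩
      rw [hD.eq_singleton_of_mem hd] at hpar
      have h2 := Set.ncard_sdiff_singleton_add_one (hDF hd)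
      grind
    rw [Set.sdiff_empty] at *
    obtain ⟨v, hv⟩ := hne
    obtain ⟨u, hu, hvu⟩ := hsafe v hv
    refine WinsFrom.avoider_round hv (hins v hv) fun w hw hwv => ?_
    have := ncard_diff_pair_lt (w := w) hv
    -- The partner `u` of `v` becomes the exceptional vertex, unless Enforcer has just taken it.
    refine winsFrom_avoider_of_matching (insert v A) (F \ {v, w}) ({u} \ {w}) (hins v hv) ?_
      (Set.subsingleton_singleton.anti Set.sdiff_subset)
      (fun _ => (even_ncard_diff_pair hv hw hwv).2 hpar) ?_
      fun x hx y hy z hz => hF x hx.1.1 y hy.1.1 z hz.1.1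
    · rintro _ ⟨rfl, hw'⟩
      refine ⟨hu, ?_⟩
      rintro (rfl | h)
      · exact hvu.ne rfl
      · exact hw' h
    · rintro x (rfl | hx) y hy hxy
      · have : y = u := hF y hy.1.1 x hv u hu hxy.symm hvu
        subst this
        exact hy.2 ⟨rfl, fun h => hy.1.2 (Or.inr h)⟩
      · exact hAF x hx y hy.1.1 hxy
termination_by F.ncard

theorem ContainsForbidden.mono {V W : Type*} {G : SimpleGraph V} {H : SimpleGraph W}
    (h : ContainsForbidden G) (hGH : G.IsContained H) : ContainsForbidden H := by
  rcases h with h | h | h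
  · exact .inl (h.trans hGH)
  · exact .inr (.inl (h.trans hGH))
  · exact .inr (.inr (h.trans hGH))

/-- Avoider wins as second-to-last player on a forbidden-subgraph-free remainder of the board
without neighbours picked by Avoider. -/
theorem winsFrom_avoider_of_not_containsForbidden {V : Type*} [Finite V] {G : SimpleGraph V}
    (hG : ¬ ContainsForbidden G) (A F : Set V) (hA : ∀ x ∈ A, ∀ y ∈ A, ¬ G.Adj x y)
    (heven : Even F.ncard) (hAF : ∀ x ∈ A, ∀ y ∈ F, ¬ G.Adj x y) :
    WinsFrom (graphHypergraph G) avoider avoider A F := by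
  rcases F.eq_empty_or_nonempty with rfl | hne
  · exact .finished _ _ (hasWon_avoider_of_independent hA)
  by_cases hiso : ∃ v ∈ F, ∀ w ∈ F, ¬ G.Adj v w
  · obtain ⟨v, hv, hvw⟩ := hiso
    have hins : ∀ x ∈ insert v A, ∀ y ∈ insert v A, ¬ G.Adj x y := by
      rintro x (rfl | hx) y (rfl | hy) hxy
      · exact hxy.ne rfl
      · exact hAF y hy x hv hxy.symm
      · exact hAF x hx y hv hxy
      · exact hA x hx y hy hxy
    refine WinsFrom.avoider_round hv hins fun w hw hwv => ?_
    have := ncard_diff_pair_lt (w := w) hv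
    refine winsFrom_avoider_of_not_containsForbidden hG _ _ hins
      ((even_ncard_diff_pair hv hw hwv).2 heven) ?_
    rintro x (rfl | hx) y hy
    · exact hvw y hy.1
    · exact hAF x hx y hy.1
  · push Not at hiso
    have := hne.to_subtype
    obtain ⟨c, hc⟩ := exists_meetsPaths (G := G.induce F)
      (fun h => hG (h.mono ⟨SimpleGraph.Copy.induce G F⟩))
      (fun v => by
        obtain ⟨w, hw, hvw⟩ := hiso v v.2
        exact ⟨⟨w, hw⟩, hvw⟩)
      (by rwa [Nat.card_coe_set_eq])
    refine winsFrom_avoider_of_matching A F {c.1} hA (by simp) Set.subsingleton_singleton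
      (fun _ => heven) (fun x hx y hy => hAF x hx y hy.1) fun x hx y hy z hz hxy hyz => ?_
    have hne : ∀ u (hu : u ∈ F \ {c.1}), (⟨u, hu.1⟩ : F) ≠ c := fun u hu h =>
      hu.2 (congrArg Subtype.val h)
    exact congrArg Subtype.val (hc ⟨x, hx.1⟩ ⟨y, hy.1⟩ ⟨z, hz.1⟩ (hne x hx) (hne y hy) (hne z hz)
      hxy hyz)
termination_by F.ncard

/-! ### From positions to outcomes -/

theorem winsWithFirst_avoider_of_no_path {V : Type*} [Finite V] {G : SimpleGraph V}
    (hG : ¬ (SimpleGraph.pathGraph 3).IsContained G) (q : Player) :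
    WinsWithFirst (graphHypergraph G) avoider q := by
  have key : ∀ F : Set V, WinsFrom (graphHypergraph G) avoider avoider ∅ F := fun F =>
    winsFrom_avoider_of_matching ∅ F ∅ (by simp) (Set.empty_subset _) Set.subsingleton_empty
      (fun h => absurd h Set.not_nonempty_empty) (by simp) fun x _ y _ z _ hxy hyz => by
        by_contra hxz
        exact hG (isContained_pathGraph_iff.2 ⟨x, y, z, hxz, hxy, hyz⟩)
  cases q with
  | avoider => exact key _
  | enforcer =>
    change WinsFrom _ _ _ _ Set.univ
    rcases (Set.univ : Set V).eq_empty_or_nonempty with h | h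
    · rw [h]
      exact .finished _ _ (hasWon_avoider_of_independent (by simp))
    · exact .otherMove _ _ h fun v _ => key _

theorem winsAsSecondToLast_avoider {V : Type*} [Finite V] {G : SimpleGraph V}
    (hG : ¬ ContainsForbidden G) : WinsAsSecondToLast (graphHypergraph G) avoider := by
  change WinsFrom _ _ (if Odd (Set.univ : Set V).ncard then enforcer else avoider) _ Set.univ
  -- Enforcer is last: in odd order Enforcer moves first, so in both cases Avoider gets to move with
  -- an even number of vertices left.
  split_ifs with h
  · refine .otherMove _ _ (Set.nonempty_of_ncard_ne_zero h.pos.ne') fun v hv => ?_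
    refine winsFrom_avoider_of_not_containsForbidden hG ∅ _ (by simp) ?_ (by simp)
    have := Set.ncard_sdiff_singleton_add_one hv
    grind
  · exact winsFrom_avoider_of_not_containsForbidden hG ∅ _ (by simp) (by simpa using h) (by simp)

theorem winsAsSecondToLast_enforcer {V : Type*} [Finite V] {G : SimpleGraph V}
    (hG : (SimpleGraph.pathGraph 3).IsContained G) :
    WinsAsSecondToLast (graphHypergraph G) enforcer := by
  obtain ⟨x, y, z, hxz, hxy, hyz⟩ := isContained_pathGraph_iff.1 hG
  have hcard : ({x, y, z} : Set V).ncard = 3 :=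
    Set.ncard_eq_three.2 ⟨x, y, z, hxy.ne, hxz, hyz.ne, rfl⟩
  refine WinsFrom.enforcer_extend (l := avoider) ?_ (Set.subset_univ {x, y, z})
  rw [hcard, if_pos (by decide)]
  exact winsFrom_enforcer_path hxz hxy hyz

theorem winsAsLast_enforcer_of_even {V : Type*} [Finite V] {G : SimpleGraph V} {S : Set V}
    (hS : Even S.ncard) (h : WinsFrom (graphHypergraph G) enforcer avoider ∅ S) :
    WinsAsLast (graphHypergraph G) enforcer := by
  refine WinsFrom.enforcer_extend (l := enforcer) ?_ (Set.subset_univ S)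
  rwa [if_neg (by simpa using hS)]

theorem ncard_eq_six {V : Type*} {a b c x y z : V} (h : [a, b, c, x, y, z].Nodup) :
    ({a, b, c, x, y, z} : Set V).ncard = 6 := by
  rw [List.nodup_cons] at h
  rw [Set.ncard_insert_of_notMem (by simpa using h.1), ncard_eq_five h.2]

theorem winsAsLast_enforcer {V : Type*} [Finite V] {G : SimpleGraph V}
    (hG : ContainsForbidden G) : WinsAsLast (graphHypergraph G) enforcer := by
  rcases hG with h | h | h
  · obtain ⟨a, b, c, x, y, z, hn, hab, hbc, hxy, hyz⟩ := isContained_twoP3_iff.1 h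
    exact winsAsLast_enforcer_of_even (by rw [ncard_eq_six hn]; decide)
      (winsFrom_enforcer_two_paths hn hab hbc hxy hyz ∅)
  · obtain ⟨f⟩ := h
    refine winsAsLast_enforcer_of_even ?_ (winsFrom_enforcer_cycle f.injective
      (f.toHom.map_adj (by decide)) (f.toHom.map_adj (by decide)) (f.toHom.map_adj (by decide))
      (f.toHom.map_adj (by decide)) ∅)
    rw [← Set.image_univ, Set.ncard_image_of_injective _ f.injective, Set.ncard_univ,
      Nat.card_eq_fintype_card, Fintype.card_fin]
    decide
  · obtain ⟨a, b, c, x, y, z, hn, hab, hbc, hca, hax, hby, hcz⟩ := isContained_sunlet3_iff.1 h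
    exact winsAsLast_enforcer_of_even (by rw [ncard_eq_six hn]; decide)
      (winsFrom_enforcer_sunlet hn hab hbc hca hax hby hcz ∅)

theorem ContainsForbidden.isContained_pathGraph {V : Type*} {G : SimpleGraph V}
    (hG : ContainsForbidden G) : (SimpleGraph.pathGraph 3).IsContained G := by
  rw [isContained_pathGraph_iff]
  rcases hG with h | h | h
  · obtain ⟨a, b, c, x, y, z, hn, hab, hbc, -⟩ := isContained_twoP3_iff.1 h
    exact ⟨a, b, c, by grind, hab, hbc⟩
  · obtain ⟨a, b, c, d, hac, -, hab, hbc, -⟩ := isContained_cycleGraph_iff.1 h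
    exact ⟨a, b, c, hac, hab, hbc⟩
  · obtain ⟨a, b, c, x, y, z, -, hab, hbc, hca, -⟩ := isContained_sunlet3_iff.1 h
    exact ⟨a, b, c, hca.ne', hab, hbc⟩

end AvoiderEnforcer

theorem theorem3 {V : Type*} [Finite V] (G : SimpleGraph V) :
    (AvoiderEnforcer.HasOutcome (AvoiderEnforcer.graphHypergraph G) .A ↔
      ¬ (SimpleGraph.pathGraph 3).IsContained G) ∧
    (AvoiderEnforcer.HasOutcome (AvoiderEnforcer.graphHypergraph G) .E ↔
      AvoiderEnforcer.ContainsForbidden G) ∧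
    (AvoiderEnforcer.HasOutcome (AvoiderEnforcer.graphHypergraph G) .SL ↔
      (SimpleGraph.pathGraph 3).IsContained G ∧ ¬ AvoiderEnforcer.ContainsForbidden G) := by
  open AvoiderEnforcer in
  refine ⟨⟨fun h hP => ?_, fun hP => ?_⟩, ⟨fun h => ?_, fun hF => ?_⟩, ⟨fun h => ⟨?_, fun hF => ?_⟩,
    fun h => ?_⟩⟩
  · exact WinsFrom.not_avoider_and_enforcer h.1 (winsAsSecondToLast_enforcer hP)
  · exact ⟨winsWithFirst_avoider_of_no_path hP _, winsWithFirst_avoider_of_no_path hP _⟩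
  · by_contra hF
    exact WinsFrom.not_avoider_and_enforcer (winsAsSecondToLast_avoider hF) h.1
  · exact ⟨winsAsLast_enforcer hF, winsAsSecondToLast_enforcer hF.isContained_pathGraph⟩
  · by_contra hP
    exact WinsFrom.not_avoider_and_enforcer (winsWithFirst_avoider_of_no_path hP _) h.2
  · exact WinsFrom.not_avoider_and_enforcer h.1 (winsAsLast_enforcer hF)
  · exact ⟨winsAsSecondToLast_avoider h.2, winsAsSecondToLast_enforcer h.1⟩
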